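/- Let $V,H$ be measurable spaces (with measurable singletons in $V$), $\mu_V,\mu_H$ $\sigma$-finite reference measures on them, $X=V\times H$ and $\mu=\mu_V\otimes\mu_H\neq0$; $V$ carries the observable and $H$ the latent variables. Let $\mathcal P=\{P_\eta:\eta\in\Theta\}$ be an exponential family on $X$ in natural parameters: $\Theta\subseteq\mathbb R^d$ is open, $T:X\to\mathbb R^d$ is measurable, $P_\eta$ has the density $p_\eta(x)=\exp(\eta\cdot T(x)-\psi(\eta))$ with respect to $\mu$, where $\psi(\eta)=\log\int_X e^{\eta\cdot T}\,d\mu$ and $e^{\eta\cdot T}$ is $\mu$-integrable for every $\eta\in\Theta$, and $\eta\mapsto P_\eta$ is injective on $\Theta$. Let $\mathcal Q=\{P_\eta:\eta\in S\}$, where $S\subseteq\Theta$ is a smooth (embedded) submanifold of $\mathbb R^d$. Let $\boldsymbol\sigma=(s_1,\dots,s_n)$, $n\ge1$, be a repeated observation of points $s_i\in V$, and $P_{\boldsymbol\sigma}=\frac1n\sum_i\delta_{s_i}$ its empirical distribution on $V$. Let $\mathcal E_{\boldsymbol\sigma}$ be the set of all probability measures $P_{\boldsymbol\sigma}(dv)\,\kappa(v,dh)$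 on $X$, where $\kappa$ is a Markov kernel from $V$ to $H$ with $\kappa(v,\cdot)\ll\mu_H$ for all $v$. (The absolutely continuous empirical model $\mathcal E$ is the union of the sets $\mathcal E_{\boldsymbol\sigma}$ over all finite observations.) Call $Q=P_{\hat\eta}\in\mathcal Q$ a *geodesic projection* of a probability measure $P$ to $\mathcal Q$ if the $m$-geodesic $\gamma(t)=(1-t)P+tQ$, $t\in[0,1]$, meets $\mathcal Q$ orthogonally at $Q$: for every vector $u$ tangent to $S$ at $\hat\eta$, the score $\ell_u=\partial_u\log p_\eta|_{\eta=\hat\eta}$ is integrable with respect to $P$ and $Q$, and $\frac{d}{dt}\big|_{t=1^-}\int\ell_u\,d\gamma(t)=0$. For a divergence $D$, a *minimal geodesic projection of $\mathcal E_{\boldsymbol\sigma}$ to $\mathcal Q$* is a pair $(P,Q)\in\mathcal E_{\boldsymbol\sigma}\times\mathcal Q$ such that $Q$ is a geodesic projection of $P$ to $\mathcal Q$ and $D[P\|Q]\le D[P'\|Q']$ for all $(P',Q')\in\mathcal E_{\boldsymbol\sigma}\times\mathcal Q$. 1. Suppose $\mu_V(\{s_i\})>0$ for all $i$. Then $Q\in\mathcal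 Q$ is a maximum likelihood estimate, i.e. it maximises $L[Q\mid\boldsymbol\sigma]=\prod_iQ(\{s_i\}\times H)$ over $\mathcal Q$, if and only if there is a $P\in\mathcal E_{\boldsymbol\sigma}$ such that $(P,Q)$ is a minimal geodesic projection of $\mathcal E_{\boldsymbol\sigma}$ to $\mathcal Q$ for the Kullback–Leibler divergence $D_{\mathrm{KL}}[P\|Q]$. 2. For arbitrary points $s_i\in V$ (for instance with $\mu_V$ the Lebesgue measure) suppose that the marginal densities $p_\eta^V(s_i)=\int_Hp_\eta(s_i,h)\,d\mu_H(h)$ are finite for all $i$ and all $\eta\in\Theta$. Then $Q=P_{\hat\eta}\in\mathcal Q$ is a maximum likelihood estimate, i.e. $\hat\eta$ maximises $\prod_ip^V_\eta(s_i)$ over $S$, if and only if there is a $P\in\mathcal E_{\boldsymbol\sigma}$ such that $(P,Q)$ is a minimal geodesic projection of $\mathcal E_{\boldsymbol\sigma}$ to $\mathcal Q$ for the divergence $$D_{\boldsymbol\sigma}[P\|P_\eta]=\int_X\log\frac{p(h\mid v)}{p_\eta(v,h)}\,dP(v,h)\in(-\infty,+\infty],\qquad p(h\mid v)=\frac{dP}{d(P_{\boldsymbol\sigma}\otimes\mu_H)}(v,h),$$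 that is, the Kullback–Leibler divergence $\int p\log(p/p_\eta)$ without the term $\int p(v)\log p(v)\,dv$, which depends on $\boldsymbol\sigma$ alone. -/

import Mathlib

open MeasureTheory ProbabilityTheory InformationTheory Filter Topology
open scoped ENNReal

noncomputable section

namespace LatentExp

/-- The parameter space `ℝᵈ` with its Euclidean inner product. -/
abbrev Param (d : ℕ) : Type := EuclideanSpace ℝ (Fin d)

/-- A (regular, identifiable) exponential family with respect to the reference measure `m`, in
natural parameters. It is given by the statistic `T` and by the open set `Θ` of natural parameters.
Its members are the measures `F.dist η`, `η ∈ Θ`, defined below. -/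
structure ExpFamily {X : Type*} [MeasurableSpace X] (m : Measure X) (d : ℕ) where
  /-- the statistic -/
  T : X → Param d
  measurable_T : Measurable T
  /-- the natural parameters of the members of the family -/
  Θ : Set (Param d)
  isOpen_Θ : IsOpen Θ
  reference_ne_zero : m ≠ 0
  integrable_exp : ∀ η ∈ Θ, Integrable (fun x => Real.exp (inner ℝ η (T x))) m
  /-- different parameters belong to different distributions -/
  identifiable : ∀ η ∈ Θ, ∀ η' ∈ Θ,
    m.withDensity (fun x => ENNReal.ofReal
        (Real.exp (inner ℝ η (T x) - Real.log (∫ y, Real.exp (inner ℝ η (T y)) ∂m)))) =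
      m.withDensity (fun x => ENNReal.ofReal
        (Real.exp (inner ℝ η' (T x) - Real.log (∫ y, Real.exp (inner ℝ η' (T y)) ∂m)))) →
    η = η'

namespace ExpFamily

variable {X : Type*} [MeasurableSpace X] {m : Measure X} {d : ℕ}

/-- The cumulant generating function `ψ(η) = log ∫ exp (η · T) dm`. -/
def cumulant (F : ExpFamily m d) (η : Param d) : ℝ :=
  Real.log (∫ x, Real.exp (inner ℝ η (F.T x)) ∂m)

/-- The logarithm `η · T(x) - ψ(η)` of the density of the member with parameter `η`. -/
def logDensity (F : ExpFamily m d) (η : Param d) (x : X) : ℝ :=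
  inner ℝ η (F.T x) - F.cumulant η

/-- The member of the family with natural parameter `η`. -/
def dist (F : ExpFamily m d) (η : Param d) : Measure X :=
  m.withDensity (fun x => ENNReal.ofReal (Real.exp (F.logDensity η x)))

/-- The score at `η` in the direction `u`: the derivative of the log-density along `u`. -/
def score (F : ExpFamily m d) (η u : Param d) (x : X) : ℝ :=
  fderiv ℝ (fun ζ => F.logDensity ζ x) η u

end ExpFamily

/-! ### Smooth submanifolds and their tangent vectors -/

/-- `S` is an (embedded) smooth `k`-dimensional submanifold of `ℝᵈ`: near each of its points a
smooth change of coordinates turns `S` into a `k`-dimensional linear subspace. -/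
def IsSmoothSubmanifold {d : ℕ} (k : ℕ) (S : Set (Param d)) : Prop :=
  ∀ x ∈ S, ∃ (Φ : OpenPartialHomeomorph (Param d) (Param d)) (W : Submodule ℝ (Param d)),
    x ∈ Φ.source ∧ ContDiffOn ℝ (⊤ : ℕ∞) Φ Φ.source ∧ ContDiffOn ℝ (⊤ : ℕ∞) Φ.symm Φ.target ∧
      Module.finrank ℝ W = k ∧ Φ.IsImage S (W : Set (Param d))

/-- `u` is tangent to `S` at `x`: it is the velocity of a curve in `S` through `x`. -/
def IsTangentVector {d : ℕ} (S : Set (Param d)) (x u : Param d) : Prop :=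
  ∃ γ : ℝ → Param d, γ 0 = x ∧ (∀ᶠ t in 𝓝 (0 : ℝ), γ t ∈ S) ∧ HasDerivAt γ u 0

/-! ### Geodesic projections -/

/-- The `m`-geodesic (mixture) from `P` at `t = 0` to `Q` at `t = 1`. -/
def mGeodesic {X : Type*} [MeasurableSpace X] (P Q : Measure X) (t : ℝ) : Measure X :=
  ENNReal.ofReal (1 - t) • P + ENNReal.ofReal t • Q

/-- The member of `F` with parameter `η` is a geodesic projection of `P` to the submanifold of `F`
with parameter set `S`: the `m`-geodesic from `P` to this member meets the submanifold
orthogonally. The Fisher inner product of the velocity of a curve of measures `γ` with the tangent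
vector `u` is the derivative of `t ↦ ∫ ℓ dγ(t)`, where `ℓ` is the (fixed) score at the end point
in the direction `u`. -/
def IsGeodesicProjection {X : Type*} [MeasurableSpace X] {m : Measure X} {d : ℕ}
    (F : ExpFamily m d) (S : Set (Param d)) (P : Measure X) (η : Param d) : Prop :=
  η ∈ S ∧ ∀ u : Param d, IsTangentVector S η u →
    Integrable (F.score η u) P ∧ Integrable (F.score η u) (F.dist η) ∧
      HasDerivWithinAt (fun t : ℝ => ∫ x, F.score η u x ∂(mGeodesic P (F.dist η) t)) 0
        (Set.Icc 0 1) 1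

/-- The pair of `P ∈ 𝓔` and the member with parameter `η ∈ S` is a minimal geodesic projection of
`𝓔` to the submanifold with parameter set `S`: the second point is a geodesic projection of the
first, and among all pairs of points of the two sets this pair has the least divergence `D`. -/
def IsMinimalGeodesicProjection {X : Type*} [MeasurableSpace X] {m : Measure X} {d : ℕ}
    {α : Type*} [LE α] (D : Measure X → Param d → α) (F : ExpFamily m d)
    (𝓔 : Set (Measure X)) (S : Set (Param d)) (P : Measure X) (η : Param d) : Prop :=
  P ∈ 𝓔 ∧ IsGeodesicProjection F S P η ∧ ∀ P' ∈ 𝓔, ∀ η' ∈ S, D P η ≤ D P' η'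

/-- `η` maximises the likelihood function `L` over `S`. -/
def IsMaximumLikelihoodEstimate {d : ℕ} (L : Param d → ℝ≥0∞) (S : Set (Param d))
    (η : Param d) : Prop :=
  η ∈ S ∧ ∀ η' ∈ S, L η' ≤ L η

/-! ### Observations of the first factor of `V × H` -/

section Observation

variable {V H : Type*} [MeasurableSpace V] [MeasurableSpace H]

/-- The empirical distribution on `V` of the repeated observation `s₁, …, sₙ`. -/
def empirical {n : ℕ} (s : Fin n → V) : Measure V :=
  (n : ℝ≥0∞)⁻¹ • ∑ i, Measure.dirac (s i)

/-- The absolutely continuous conditional transition probabilities from `V` to `H`. -/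
def acTransitions (V : Type*) [MeasurableSpace V] (μH : Measure H) : Set (Kernel V H) :=
  {κ | IsMarkovKernel κ ∧ ∀ v, κ v ≪ μH}

/-- The set `𝓔_σ` of the joint empirical distributions on `V × H` that are constituted by the
observation `s` and an absolutely continuous conditional transition probability. The absolutely
continuous empirical model is the union of these sets over all finite observations. -/
def empiricalSubmodel (μH : Measure H) {n : ℕ} (s : Fin n → V) : Set (Measure (V × H)) :=
  {P | ∃ κ ∈ acTransitions V μH, P = (empirical s).compProd κ}

/-- The absolutely continuous empirical model over `V × H`. -/
def acEmpiricalModel (V : Type*) [MeasurableSpace V] (μH : Measure H) : Set (Measure (V × H)) :=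
  {P | ∃ (n : ℕ) (_ : 0 < n) (s : Fin n → V), P ∈ empiricalSubmodel μH s}

/-- The probability of the observation `s` under `Q`, for independent repetitions of which only the
component in `V` is observed. -/
def likelihood {n : ℕ} (s : Fin n → V) (Q : Measure (V × H)) : ℝ≥0∞ :=
  ∏ i, Q ({s i} ×ˢ Set.univ)

variable {μV : Measure V} {μH : Measure H} {d : ℕ}

/-- The density at `v`, with respect to `μV`, of the `V`-marginal of the member with
parameter `η`. -/
def marginalDensity (F : ExpFamily (μV.prod μH) d) (η : Param d) (v : V) : ℝ≥0∞ :=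
  ∫⁻ h, ENNReal.ofReal (Real.exp (F.logDensity η (v, h))) ∂μH

/-- The likelihood of the observation `s` as a probability density with respect to `μV`. -/
def densityLikelihood (F : ExpFamily (μV.prod μH) d) {n : ℕ} (s : Fin n → V) (η : Param d) :
    ℝ≥0∞ :=
  ∏ i, marginalDensity F η (s i)

open Classical in
/-- The Kullback-Leibler divergence `∫ p log (p / q)` of `p(v, h) = p(v) p(h ∣ v)` from the density
`q` of the member with parameter `η`, without the term `∫ p(v) log p(v)`, which is determined by
the observation alone (and is infinite for point observations under a diffuse `μV`):
`∫ log (p(h ∣ v) / q(v, h)) dP`. Here `p(h ∣ v)` is the density of `P` with respect to the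
product of the empirical distribution and `μH`. For a finite `marginalDensity` at the observed
points the negative part is integrable, so the integral is `+∞` where it is not finite. -/
def conditionalDivergence (F : ExpFamily (μV.prod μH) d) {n : ℕ} (s : Fin n → V)
    (P : Measure (V × H)) (η : Param d) : EReal :=
  if Integrable (fun x => Real.log (P.rnDeriv ((empirical s).prod μH) x).toReal
      - F.logDensity η x) P
  then ((∫ x, (Real.log (P.rnDeriv ((empirical s).prod μH) x).toReal
      - F.logDensity η x) ∂P : ℝ) : EReal)
  else ⊤

end Observation

end LatentExp

end

namespace LatentExp

/-! ### The log-partition function of a statistic -/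

section LogPartition

variable {Y : Type*} [MeasurableSpace Y] {ν : Measure Y} {d : ℕ}

/-! Complete the observation by the member's own conditional distribution: `completion F s η` is
P_σ(dv) p_η(h|v) dμ_H. Since p_η(v,h) = p_η(h|v) p_η^V(v), every P in the empirical submodel
satisfies D_σ[P‖P_η] = KL(P ‖ completion) - ℓ(η), with ℓ the mean log-likelihood
(`integral_conditionalDivergence`). By Gibbs' inequality the least value over P is -ℓ(η), attained
at the completion (`neg_meanLogLikelihood_le_conditionalDivergence`,
`conditionalDivergence_completion`). Minimising over pairs is therefore maximising ℓ over S.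

Orthogonality comes for free at a maximum. By Fisher's identity
(`exists_hasFDerivAt_meanLogLikelihood`) the derivative of ℓ along u is the mean of the score under
the completion, so it vanishes for tangent u. The score also has mean zero under P_η, hence along
the whole geodesic. The converse needs minimality alone.

For atoms s_i, the likelihood changes by the factor ∏ μ_V{s_i} and the divergence by a finite
constant (`klDiv_dist_eq`), which reduces the first claim to the second. -/

lemma norm_le_sum_abs (x : Param d) : ‖x‖ ≤ ∑ j, |x j| := by
  have h := (EuclideanSpace.basisFun (Fin d) ℝ).sum_repr x
  calc ‖x‖ = ‖∑ j, x j • EuclideanSpace.basisFun (Fin d) ℝ j‖ := by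
        conv_lhs => rw [← h]
        simp
    _ ≤ ∑ j, ‖x j • EuclideanSpace.basisFun (Fin d) ℝ j‖ := norm_sum_le _ _
    _ = ∑ j, |x j| := by simp [norm_smul]

/-- The coordinate of largest modulus controls the norm up to the factor d, so exponential moments
along the 2d axis directions control one of the norm. -/
lemma exp_norm_le_sum {ε c : ℝ} (hε : 0 ≤ ε) (hc : ε * d ≤ c) (x : Param d) :
    Real.exp (ε * ‖x‖) ≤ 1 + ∑ j, (Real.exp (c * x j) + Real.exp (-(c * x j))) := by
  rcases isEmpty_or_nonempty (Fin d) with hd | hd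
  · have : ‖x‖ = 0 := by simp [Subsingleton.elim x 0]
    simp [this]
  · obtain ⟨j, -, hj⟩ := Finset.exists_max_image Finset.univ (fun j => |x j|)
      Finset.univ_nonempty
    have h1 : ‖x‖ ≤ d * |x j| := by
      refine (norm_le_sum_abs x).trans ?_
      simpa using Finset.sum_le_card_nsmul Finset.univ (fun j => |x j|) |x j| hj
    have h2 : ε * ‖x‖ ≤ c * |x j| := by
      calc ε * ‖x‖ ≤ ε * (d * |x j|) := by gcongr
        _ = (ε * d) * |x j| := by ring
        _ ≤ c * |x j| := by gcongr
    have h3 : Real.exp (c * |x j|) ≤ Real.exp (c * x j) + Real.exp (-(c * x j)) := by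
      rcases abs_choice (x j) with h | h <;> rw [h]
      · linarith [Real.exp_pos (-(c * x j))]
      · rw [mul_neg]; linarith [Real.exp_pos (c * x j)]
    have h4 := Finset.single_le_sum
      (f := fun j => Real.exp (c * x j) + Real.exp (-(c * x j)))
      (fun i _ => by positivity) (Finset.mem_univ j)
    have := Real.exp_le_exp.mpr h2
    simp only at h4
    linarith

/-- Openness of Θ leaves room for shifts of η along each axis. The extra factor exp(ε‖T‖) provides
the domination for differentiating under the integral. -/
lemma exists_integrable_exp_add_norm {T : Y → Param d} (hT : Measurable T) {Θ : Set (Param d)}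
    (hΘ : IsOpen Θ) (hint : ∀ ζ ∈ Θ, Integrable (fun y => Real.exp (inner ℝ ζ (T y))) ν)
    {η : Param d} (hη : η ∈ Θ) :
    ∃ ε > 0, Integrable (fun y => Real.exp (inner ℝ η (T y) + ε * ‖T y‖)) ν := by
  obtain ⟨r, hr, hball⟩ := Metric.isOpen_iff.mp hΘ η hη
  have hshift : ∀ (j : Fin d) (a : ℝ), |a| = r / 2 →
      Integrable (fun y => Real.exp (inner ℝ η (T y) + a * T y j)) ν := by
    intro j a ha
    have hmem : η + a • EuclideanSpace.single j (1 : ℝ) ∈ Θ := by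
      apply hball
      simp [norm_smul, ha]
      linarith
    refine (hint _ hmem).congr (Eventually.of_forall fun y => ?_)
    simp [inner_add_left, inner_smul_left, EuclideanSpace.inner_single_left]
  -- This gives ε * d ≤ r / 2; the denominator d + 1 also covers d = 0.
  refine ⟨r / 2 / (d + 1), by positivity, ?_⟩
  have hdom : Integrable (fun y => Real.exp (inner ℝ η (T y)) + ∑ j : Fin d,
      (Real.exp (inner ℝ η (T y) + r / 2 * T y j) +
        Real.exp (inner ℝ η (T y) + -(r / 2) * T y j))) ν := by
    refine (hint η hη).add (integrable_finsetSum _ fun j _ => ?_)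
    exact (hshift j _ (abs_of_pos (by positivity))).add
      (hshift j _ (by rw [abs_neg, abs_of_pos (by positivity)]))
  refine hdom.mono' (by fun_prop) (Eventually.of_forall fun y => ?_)
  rw [Real.norm_of_nonneg (Real.exp_pos _).le, Real.exp_add]
  have h := exp_norm_le_sum (ε := r / 2 / (d + 1)) (c := r / 2) (by positivity)
    (by rw [div_mul_eq_mul_div, div_le_iff₀ (by positivity)]; nlinarith) (T y)
  refine (mul_le_mul_of_nonneg_left h (Real.exp_pos _).le).trans (le_of_eq ?_)
  simp only [mul_add, mul_one, Finset.mul_sum, Real.exp_add, neg_mul]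

/-- The log-partition function is differentiable in the interior of its domain, and its derivative
is the mean of the statistic under the tilted measure. -/
theorem exists_hasFDerivAt_log_integral_exp [NeZero ν] {T : Y → Param d} (hT : Measurable T)
    {Θ : Set (Param d)} (hΘ : IsOpen Θ)
    (hint : ∀ ζ ∈ Θ, Integrable (fun y => Real.exp (inner ℝ ζ (T y))) ν)
    {η : Param d} (hη : η ∈ Θ) :
    ∃ L : Param d →L[ℝ] ℝ,
      HasFDerivAt (fun ζ => Real.log (∫ y, Real.exp (inner ℝ ζ (T y)) ∂ν)) L η ∧
      ∀ u, Integrable (fun y => inner ℝ u (T y)) (ν.tilted fun y => inner ℝ η (T y)) ∧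
        ∫ y, inner ℝ u (T y) ∂(ν.tilted fun y => inner ℝ η (T y)) = L u := by
  obtain ⟨ε, hε, hbd⟩ := exists_integrable_exp_add_norm hT hΘ hint hη
  let F' : Param d → Y → Param d →L[ℝ] ℝ := fun ζ y =>
    Real.exp (inner ℝ ζ (T y)) • innerSL ℝ (T y)
  have hmeas : ∀ ζ : Param d, AEStronglyMeasurable (F' ζ) ν := by
    intro ζ
    have h : AEStronglyMeasurable (fun y => Real.exp (inner ℝ ζ (T y))) ν := by fun_prop
    exact h.smul ((innerSL ℝ).continuous.comp_aestronglyMeasurable hT.aestronglyMeasurable)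
  -- One half of ε pays for moving from η to ζ, the other half absorbs the factor ‖T y‖ of the
  -- derivative.
  have hbound : ∀ y, ∀ ζ ∈ Metric.ball η (ε / 2),
      ‖F' ζ y‖ ≤ 2 / ε * Real.exp (inner ℝ η (T y) + ε * ‖T y‖) := by
    intro y ζ hζ
    have h1 : inner ℝ ζ (T y) ≤ inner ℝ η (T y) + ε / 2 * ‖T y‖ := by
      have h := real_inner_le_norm (ζ - η) (T y)
      rw [inner_sub_left] at h
      have : ‖ζ - η‖ * ‖T y‖ ≤ ε / 2 * ‖T y‖ := by
        gcongr
        exact (mem_ball_iff_norm.mp hζ).le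
      linarith
    have h2 : ‖T y‖ ≤ 2 / ε * Real.exp (ε / 2 * ‖T y‖) := by
      have := Real.add_one_le_exp (ε / 2 * ‖T y‖)
      rw [div_mul_eq_mul_div, le_div_iff₀ hε]
      linarith
    calc ‖F' ζ y‖ = Real.exp (inner ℝ ζ (T y)) * ‖T y‖ := by
          simp [F', norm_smul]
      _ ≤ Real.exp (inner ℝ η (T y) + ε / 2 * ‖T y‖) *
            (2 / ε * Real.exp (ε / 2 * ‖T y‖)) := by gcongr
      _ = 2 / ε * (Real.exp (inner ℝ η (T y) + ε / 2 * ‖T y‖) *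
            Real.exp (ε / 2 * ‖T y‖)) := by ring
      _ = _ := by rw [← Real.exp_add]; ring_nf
  have hF'int : Integrable (F' η) ν := (hbd.const_mul (2 / ε)).mono' (hmeas η)
    (Eventually.of_forall fun y => hbound y η (Metric.mem_ball_self (by positivity)))
  have hder : HasFDerivAt (fun ζ => ∫ y, Real.exp (inner ℝ ζ (T y)) ∂ν) (∫ y, F' η y ∂ν) η := by
    refine hasFDerivAt_integral_of_dominated_of_fderiv_le
      (F := fun (ζ : Param d) y => Real.exp (inner ℝ ζ (T y))) (F' := F')
      (bound := fun y => 2 / ε * Real.exp (inner ℝ η (T y) + ε * ‖T y‖))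
      (Metric.ball_mem_nhds η (half_pos hε))
      (Eventually.of_forall fun ζ => by fun_prop) (hint η hη) (hmeas η)
      (Eventually.of_forall hbound) (hbd.const_mul _)
      (Eventually.of_forall fun y ζ _ => ?_)
    have h : HasFDerivAt (fun ζ : Param d => inner ℝ ζ (T y)) (innerSL ℝ (T y)) ζ := by
      have := (innerSL ℝ (T y)).hasFDerivAt (x := ζ)
      refine this.congr_of_eventuallyEq (Eventually.of_forall fun z => ?_)
      simp [real_inner_comm]
    exact h.exp
  have hpos := integral_exp_pos (hint η hη)
  refine ⟨_, hder.log hpos.ne', fun u => ⟨?_, ?_⟩⟩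
  · rw [integrable_tilted_iff (hint η hη)]
    refine ((ContinuousLinearMap.apply ℝ ℝ u).integrable_comp hF'int).congr
      (Eventually.of_forall fun y => ?_)
    simp [F', real_inner_comm]
  · rw [integral_tilted, smul_apply,
      ContinuousLinearMap.integral_apply hF'int, smul_eq_mul, ← integral_const_mul]
    refine integral_congr_ae (Eventually.of_forall fun y => ?_)
    simp only [F', smul_apply, innerSL_apply_apply, smul_eq_mul,
      real_inner_comm]
    ring

end LogPartition

/-! ### Integration with respect to joint empirical distributions -/

section Empirical

variable {V H : Type*} [MeasurableSpace V] [MeasurableSpace H] {n : ℕ} {s : Fin n → V}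

instance : SFinite (empirical s) := by
  unfold empirical
  infer_instance

lemma isProbabilityMeasure_empirical (hn : 0 < n) (s : Fin n → V) :
    IsProbabilityMeasure (empirical s) := by
  constructor
  simp only [empirical, Measure.smul_apply, Measure.finsetSum_apply, measure_univ,
    Finset.sum_const, Finset.card_univ, Fintype.card_fin, smul_eq_mul, nsmul_eq_mul, mul_one]
  exact ENNReal.inv_mul_cancel (by positivity) (ENNReal.natCast_ne_top n)

lemma inv_natCast_ne_top (hn : 0 < n) : (n : ℝ≥0∞)⁻¹ ≠ ∞ := by
  simpa using hn.ne'

variable {μH : Measure H} {P : Measure (V × H)}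

lemma isProbabilityMeasure_of_mem_empiricalSubmodel (hn : 0 < n)
    (hP : P ∈ empiricalSubmodel μH s) : IsProbabilityMeasure P := by
  obtain ⟨κ, ⟨hκ, -⟩, rfl⟩ := hP
  have := isProbabilityMeasure_empirical hn s
  infer_instance

lemma absolutelyContinuous_of_mem_empiricalSubmodel [SFinite μH] (hn : 0 < n)
    (hP : P ∈ empiricalSubmodel μH s) : P ≪ (empirical s).prod μH := by
  obtain ⟨κ, ⟨hκ, hac⟩, rfl⟩ := hP
  have := isProbabilityMeasure_empirical hn s
  rw [← Measure.compProd_const]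
  exact Measure.AbsolutelyContinuous.compProd_right (Eventually.of_forall hac)

variable [MeasurableSingletonClass V]

lemma ae_empirical_iff {p : V → Prop} :
    (∀ᵐ v ∂(empirical s), p v) ↔ ∀ i, p (s i) := by
  rw [empirical, Measure.ae_ennreal_smul_measure_eq (ENNReal.inv_ne_zero.mpr (ENNReal.natCast_ne_top n)),
    ← Measure.sum_fintype, Measure.ae_sum_iff]
  simp

lemma empirical_compProd (κ : Kernel V H) [IsSFiniteKernel κ] :
    (empirical s).compProd κ = (n : ℝ≥0∞)⁻¹ • ∑ i, (κ (s i)).map (Prod.mk (s i)) := by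
  ext A hA
  rw [Measure.compProd_apply hA, empirical, lintegral_smul_measure, lintegral_finsetSum_measure]
  simp only [lintegral_dirac, Measure.smul_apply, Measure.finsetSum_apply]
  congr 1
  exact Finset.sum_congr rfl fun i _ => (Measure.map_apply measurable_prodMk_left hA).symm

lemma ae_empirical_compProd {κ : Kernel V H} [IsSFiniteKernel κ] {p : V → Prop}
    (h : ∀ i, p (s i)) : ∀ᵐ x ∂(empirical s).compProd κ, p x.1 := by
  -- As p need not be measurable, it is replaced by the finite, hence measurable, set of observed
  -- points.
  obtain ⟨t, ht, hpt, h0⟩ : ∃ t : Set V, (∀ v ∈ t, p v) ∧ MeasurableSet t ∧ ∀ i, s i ∈ t :=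
    ⟨Set.range s, by rintro _ ⟨i, rfl⟩; exact h i, (Set.finite_range s).measurableSet,
      fun i => ⟨i, rfl⟩⟩
  have hae : ∀ᵐ x ∂(empirical s).compProd κ, x.1 ∈ t :=
    (Measure.ae_compProd_iff (measurable_fst hpt)).mpr
      ((ae_empirical_iff.mpr h0).mono fun v hv => Eventually.of_forall fun _ => hv)
  exact hae.mono fun x hx => ht _ hx

lemma integrable_empirical_compProd (hn : 0 < n) {κ : Kernel V H} [IsSFiniteKernel κ]
    {f : V × H → ℝ} (hf : Measurable f) (h : ∀ i, Integrable (fun y => f (s i, y)) (κ (s i))) :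
    Integrable f ((empirical s).compProd κ) := by
  rw [empirical_compProd]
  refine Integrable.smul_measure (integrable_finsetSum_measure.mpr fun i _ => ?_)
    (inv_natCast_ne_top hn)
  exact (integrable_map_measure hf.aestronglyMeasurable measurable_prodMk_left.aemeasurable).mpr
    (h i)

lemma integral_empirical_compProd {κ : Kernel V H} [IsSFiniteKernel κ]
    {f : V × H → ℝ} (hf : Measurable f) (h : ∀ i, Integrable (fun y => f (s i, y)) (κ (s i))) :
    ∫ x, f x ∂((empirical s).compProd κ) = (n : ℝ)⁻¹ * ∑ i, ∫ y, f (s i, y) ∂κ (s i) := by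
  rw [empirical_compProd, integral_smul_measure, integral_finsetSum_measure]
  · simp only [ENNReal.toReal_inv, ENNReal.toReal_natCast, smul_eq_mul]
    congr 1
    exact Finset.sum_congr rfl fun i _ =>
      integral_map measurable_prodMk_left.aemeasurable hf.aestronglyMeasurable
  · exact fun i _ => (integrable_map_measure hf.aestronglyMeasurable
      measurable_prodMk_left.aemeasurable).mpr (h i)

/-- The V-marginal has finite support, so terms depending on v alone can always be split off from an
integral. -/
lemma integrable_fst_of_mem_empiricalSubmodel (hn : 0 < n) (hP : P ∈ empiricalSubmodel μH s)
    {g : V → ℝ} (hg : Measurable g) : Integrable (fun x => g x.1) P := by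
  obtain ⟨κ, ⟨hκ, -⟩, rfl⟩ := hP
  exact integrable_empirical_compProd hn (f := fun x => g x.1) (hg.comp measurable_fst)
    fun i => integrable_const (g (s i))

lemma integral_fst_of_mem_empiricalSubmodel (hP : P ∈ empiricalSubmodel μH s)
    {g : V → ℝ} (hg : Measurable g) : ∫ x, g x.1 ∂P = (n : ℝ)⁻¹ * ∑ i, g (s i) := by
  obtain ⟨κ, ⟨hκ, -⟩, rfl⟩ := hP
  rw [integral_empirical_compProd (f := fun x => g x.1) (hg.comp measurable_fst)
    fun i => integrable_const (g (s i))]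
  simp

lemma empirical_absolutelyContinuous {μV : Measure V} (hs : ∀ i, μV {s i} ≠ 0) : empirical s ≪ μV := by
  intro A hA
  have h : ∀ᵐ v ∂(empirical s), v ∉ A := ae_empirical_iff.mpr fun i hi =>
    hs i (measure_mono_null (Set.singleton_subset_iff.mpr hi) hA)
  simpa [ae_iff] using h

end Empirical

/-! ### Members of the family and their conditional distributions -/

section Family

variable {X : Type*} [MeasurableSpace X] {m : Measure X} {d : ℕ} (F : ExpFamily m d)
  {η : Param d}

namespace ExpFamily

lemma measurable_logDensity (η : Param d) : Measurable (F.logDensity η) := by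
  have := F.measurable_T
  unfold logDensity
  fun_prop

lemma dist_eq_tilted (hη : η ∈ F.Θ) : F.dist η = m.tilted fun x => inner ℝ η (F.T x) := by
  have : NeZero m := ⟨F.reference_ne_zero⟩
  simp only [dist, Measure.tilted, logDensity, cumulant, Real.exp_sub,
    Real.exp_log (integral_exp_pos (F.integrable_exp η hη))]

lemma absolutelyContinuous_dist (η : Param d) : m ≪ F.dist η :=
  withDensity_absolutelyContinuous'
    (F.measurable_logDensity η).exp.ennreal_ofReal.aemeasurable
    (Eventually.of_forall fun _ => (ENNReal.ofReal_pos.mpr (Real.exp_pos _)).ne')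

lemma isProbabilityMeasure_dist (hη : η ∈ F.Θ) : IsProbabilityMeasure (F.dist η) := by
  have : NeZero m := ⟨F.reference_ne_zero⟩
  rw [F.dist_eq_tilted hη]
  exact isProbabilityMeasure_tilted (F.integrable_exp η hη)

/-- The cumulant generating function is differentiable, the score is the deviation of the statistic
from the derivative, and its mean vanishes. -/
theorem exists_hasFDerivAt_cumulant (hη : η ∈ F.Θ) :
    ∃ L : Param d →L[ℝ] ℝ, HasFDerivAt F.cumulant L η ∧
      ∀ u, (F.score η u = fun x => inner ℝ u (F.T x) - L u) ∧
        Integrable (F.score η u) (F.dist η) ∧ ∫ x, F.score η u x ∂(F.dist η) = 0 := by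
  have : NeZero m := ⟨F.reference_ne_zero⟩
  have hprob := F.isProbabilityMeasure_dist hη
  obtain ⟨L, hL, hmean⟩ :=
    exists_hasFDerivAt_log_integral_exp F.measurable_T F.isOpen_Θ F.integrable_exp hη
  rw [← F.dist_eq_tilted hη] at hmean
  refine ⟨L, hL, fun u => ?_⟩
  have hscore : F.score η u = fun x => inner ℝ u (F.T x) - L u := by
    funext x
    have h : HasFDerivAt (fun ζ : Param d => inner ℝ ζ (F.T x)) (innerSL ℝ (F.T x)) η := by
      have := (innerSL ℝ (F.T x)).hasFDerivAt (x := η)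
      refine this.congr_of_eventuallyEq (Eventually.of_forall fun z => ?_)
      simp [real_inner_comm]
    have h' : HasFDerivAt (fun ζ => F.logDensity ζ x) (innerSL ℝ (F.T x) - L) η := h.sub hL
    simp [score, h'.fderiv, real_inner_comm]
  rw [hscore]
  refine ⟨rfl, (hmean u).1.sub (integrable_const _), ?_⟩
  rw [integral_sub (hmean u).1 (integrable_const _), (hmean u).2]
  simp

end ExpFamily

lemma isGeodesicProjection_of_integral_score_eq_zero {S : Set (Param d)} {P : Measure X}
    (hηS : η ∈ S) (hηΘ : η ∈ F.Θ)
    (h : ∀ u, IsTangentVector S η u → Integrable (F.score η u) P ∧ ∫ x, F.score η u x ∂P = 0) :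
    IsGeodesicProjection F S P η := by
  obtain ⟨L, -, hL⟩ := F.exists_hasFDerivAt_cumulant hηΘ
  refine ⟨hηS, fun u hu => ?_⟩
  obtain ⟨hP, hP0⟩ := h u hu
  obtain ⟨-, hQ, hQ0⟩ := hL u
  refine ⟨hP, hQ, ?_⟩
  -- Both end points give the score mean zero, so this holds for every t, even where
  -- `ENNReal.ofReal` truncates the weights.
  have hzero : ∀ t, ∫ x, F.score η u x ∂(mGeodesic P (F.dist η) t) = 0 := by
    intro t
    rw [mGeodesic, integral_add_measure (hP.smul_measure ENNReal.ofReal_ne_top)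
      (hQ.smul_measure ENNReal.ofReal_ne_top), integral_smul_measure, integral_smul_measure,
      hP0, hQ0]
    simp
  simp only [hzero]
  exact hasDerivWithinAt_const _ _ _

end Family

section Conditional

variable {V H : Type*} [MeasurableSpace V] [MeasurableSpace H]
  {μV : Measure V} {μH : Measure H} {d : ℕ} (F : ExpFamily (μV.prod μH) d) {η : Param d} {v : V}

lemma neZero_of_expFamily (F : ExpFamily (μV.prod μH) d) : NeZero μH :=
  ⟨by rintro rfl; exact F.reference_ne_zero (Measure.prod_zero μV)⟩

lemma measurable_logDensity_right (η : Param d) (v : V) :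
    Measurable fun h => F.logDensity η (v, h) :=
  (F.measurable_logDensity η).comp measurable_prodMk_left

lemma integrable_exp_right (hv : marginalDensity F η v ≠ ∞) :
    Integrable (fun h => Real.exp (inner ℝ η (F.T (v, h)))) μH := by
  have hm := measurable_logDensity_right F η v
  have h : Integrable (fun h => Real.exp (F.logDensity η (v, h))) μH := by
    refine ⟨hm.exp.aestronglyMeasurable, ?_⟩
    rw [hasFiniteIntegral_iff_ofReal (Eventually.of_forall fun _ => (Real.exp_pos _).le)]
    exact hv.lt_top
  refine (h.const_mul (Real.exp (F.cumulant η))).congr (Eventually.of_forall fun y => ?_)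
  simp only [ExpFamily.logDensity, ← Real.exp_add]
  ring_nf

lemma marginalDensity_ne_zero (η : Param d) (v : V) : marginalDensity F η v ≠ 0 := by
  have := neZero_of_expFamily F
  have hm := measurable_logDensity_right F η v
  rw [marginalDensity, Ne, lintegral_eq_zero_iff (by fun_prop)]
  intro h
  obtain ⟨y, hy⟩ := h.exists
  simp only [Pi.zero_apply, ENNReal.ofReal_eq_zero] at hy
  exact (Real.exp_pos _).not_ge hy

lemma marginalDensity_eq_ofReal (hv : marginalDensity F η v ≠ ∞) :
    marginalDensity F η v =
      ENNReal.ofReal ((∫ h, Real.exp (inner ℝ η (F.T (v, h))) ∂μH) / Real.exp (F.cumulant η)) := by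
  have hint := integrable_exp_right F hv
  simp only [marginalDensity, ExpFamily.logDensity, Real.exp_sub]
  rw [← ofReal_integral_eq_lintegral_ofReal (hint.div_const _)
    (Eventually.of_forall fun _ => by positivity), integral_div]

/-- The fibre over v carries an exponential family with statistic T(v, ·); this expresses the
marginal through its log-partition function. -/
lemma log_marginalDensity (hv : marginalDensity F η v ≠ ∞) :
    Real.log (marginalDensity F η v).toReal =
      Real.log (∫ h, Real.exp (inner ℝ η (F.T (v, h))) ∂μH) - F.cumulant η := by
  have := neZero_of_expFamily F
  have hpos := integral_exp_pos (integrable_exp_right F hv)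
  rw [marginalDensity_eq_ofReal F hv, ENNReal.toReal_ofReal (by positivity),
    Real.log_div hpos.ne' (Real.exp_pos _).ne', Real.log_exp]

/-- The mean log-likelihood of the observation. -/
noncomputable def meanLogLikelihood {n : ℕ} (s : Fin n → V) (η : Param d) : ℝ :=
  (n : ℝ)⁻¹ * ∑ i, Real.log (marginalDensity F η (s i)).toReal

lemma densityLikelihood_le_iff {n : ℕ} {s : Fin n → V} {η' : Param d} (hn : 0 < n)
    (hη : ∀ i, marginalDensity F η (s i) ≠ ∞) (hη' : ∀ i, marginalDensity F η' (s i) ≠ ∞) :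
    densityLikelihood F s η ≤ densityLikelihood F s η' ↔
      meanLogLikelihood F s η ≤ meanLogLikelihood F s η' := by
  have key : ∀ ζ : Param d, (∀ i, marginalDensity F ζ (s i) ≠ ∞) →
      densityLikelihood F s ζ ≠ ∞ ∧ 0 < (densityLikelihood F s ζ).toReal ∧
      Real.log (densityLikelihood F s ζ).toReal = n * meanLogLikelihood F s ζ := by
    intro ζ hζ
    have hne : ∀ i, (marginalDensity F ζ (s i)).toReal ≠ 0 := fun i =>
      (ENNReal.toReal_pos (marginalDensity_ne_zero F ζ (s i)) (hζ i)).ne'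
    refine ⟨ENNReal.prod_ne_top fun i _ => hζ i, ?_, ?_⟩
    · rw [densityLikelihood, ENNReal.toReal_prod]
      exact Finset.prod_pos fun i _ => (hne i).symm.lt_of_le ENNReal.toReal_nonneg
    · rw [densityLikelihood, ENNReal.toReal_prod, Real.log_prod fun i _ => hne i,
        meanLogLikelihood, mul_inv_cancel_left₀ (by positivity)]
  obtain ⟨h1, h2, h3⟩ := key η hη
  obtain ⟨h1', h2', h3'⟩ := key η' hη'
  rw [← ENNReal.toReal_le_toReal h1 h1', ← Real.log_le_log_iff h2 h2', h3, h3',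
    mul_le_mul_iff_right₀ (by positivity)]

variable [SigmaFinite μH]

lemma measurable_marginalDensity (η : Param d) : Measurable (marginalDensity F η) :=
  ((F.measurable_logDensity η).exp.ennreal_ofReal).lintegral_prod_right'

lemma measurable_conditionalDensity (η : Param d) :
    Measurable (Function.uncurry fun v h =>
      ENNReal.ofReal (Real.exp (F.logDensity η (v, h))) / marginalDensity F η v) :=
  ((F.measurable_logDensity η).exp.ennreal_ofReal).div
    ((measurable_marginalDensity F η).comp measurable_fst)

open Classical in
/-- The conditional distribution of the latent variables given the observable under the member
with parameter `η`. -/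
noncomputable def conditionalKernel (η : Param d) : Kernel V H :=
  Kernel.piecewise
    (s := marginalDensity F η ⁻¹' {∞}ᶜ)
    (measurable_marginalDensity F η (measurableSet_singleton ∞).compl)
    (Kernel.withDensity (Kernel.const V μH) fun v h =>
      ENNReal.ofReal (Real.exp (F.logDensity η (v, h))) / marginalDensity F η v)
    (Kernel.const V μH.toFinite)

open Classical in
lemma conditionalKernel_apply (hv : marginalDensity F η v ≠ ∞) :
    conditionalKernel F η v = μH.withDensity fun h =>
      ENNReal.ofReal (Real.exp (F.logDensity η (v, h))) / marginalDensity F η v := by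
  rw [conditionalKernel, Kernel.piecewise_apply, if_pos (by simpa using hv),
    Kernel.withDensity_apply _ (measurable_conditionalDensity F η), Kernel.const_apply]

open Classical in
lemma conditionalKernel_apply_of_eq_top (hv : marginalDensity F η v = ∞) :
    conditionalKernel F η v = μH.toFinite := by
  rw [conditionalKernel, Kernel.piecewise_apply, if_neg (by simp [hv]), Kernel.const_apply]

lemma conditionalKernel_eq_tilted (hv : marginalDensity F η v ≠ ∞) :
    conditionalKernel F η v = μH.tilted fun h => inner ℝ η (F.T (v, h)) := by
  have := neZero_of_expFamily F
  have hpos := integral_exp_pos (integrable_exp_right F hv)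
  rw [conditionalKernel_apply F hv, Measure.tilted, marginalDensity_eq_ofReal F hv]
  congr 1
  funext h
  rw [← ENNReal.ofReal_div_of_pos (by positivity), ExpFamily.logDensity, Real.exp_sub]
  congr 1
  field_simp

/-- The conditions concern every v, observed or not. Where the marginal density is infinite, the
value `μH.toFinite` is a probability measure because μ_H ≠ 0. -/
lemma conditionalKernel_mem_acTransitions (η : Param d) :
    conditionalKernel F η ∈ acTransitions V μH := by
  have := neZero_of_expFamily F
  refine ⟨⟨fun v => ?_⟩, fun v => ?_⟩ <;> by_cases hv : marginalDensity F η v = ∞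
  · rw [conditionalKernel_apply_of_eq_top F hv]
    infer_instance
  · rw [conditionalKernel_eq_tilted F hv]
    exact isProbabilityMeasure_tilted (integrable_exp_right F hv)
  · rw [conditionalKernel_apply_of_eq_top F hv]
    exact toFinite_absolutelyContinuous μH
  · rw [conditionalKernel_eq_tilted F hv]
    exact tilted_absolutelyContinuous _ _

/-- The joint distribution of the empirical distribution of the observation and the conditional
distribution of the latent variables under the member with parameter `η`. -/
noncomputable def completion {n : ℕ} (s : Fin n → V) (η : Param d) : Measure (V × H) :=
  (empirical s).compProd (conditionalKernel F η)

lemma completion_mem {n : ℕ} (s : Fin n → V) (η : Param d) :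
    completion F s η ∈ empiricalSubmodel μH s :=
  ⟨_, conditionalKernel_mem_acTransitions F η, rfl⟩

end Conditional

/-! ### Divergences from the empirical model -/

section Divergence

variable {V H : Type*} [MeasurableSpace V] [MeasurableSingletonClass V] [MeasurableSpace H]
  {μV : Measure V} {μH : Measure H} [SigmaFinite μH] {d n : ℕ} (F : ExpFamily (μV.prod μH) d)
  {s : Fin n → V} {η : Param d} {P : Measure (V × H)}

lemma ae_prod_ne_top (hη : ∀ i, marginalDensity F η (s i) ≠ ∞) :
    ∀ᵐ x ∂(empirical s).prod μH, marginalDensity F η x.1 ≠ ∞ := by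
  rw [← Measure.compProd_const]
  exact ae_empirical_compProd (p := fun v => marginalDensity F η v ≠ ∞) hη

/-- Only the fibres over the observed points matter, and there the kernel is given by the
conditional density. -/
lemma completion_eq_withDensity (hη : ∀ i, marginalDensity F η (s i) ≠ ∞) :
    completion F s η = ((empirical s).prod μH).withDensity fun x =>
      ENNReal.ofReal (Real.exp (F.logDensity η x)) / marginalDensity F η x.1 := by
  have hκ := (conditionalKernel_mem_acTransitions (V := V) F η).1
  have hm : Measurable fun x : V × H =>
      ENNReal.ofReal (Real.exp (F.logDensity η x)) / marginalDensity F η x.1 :=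
    measurable_conditionalDensity F η
  ext A hA
  rw [completion, Measure.compProd_apply hA, withDensity_apply _ hA, ← lintegral_indicator hA,
    lintegral_prod _ (hm.indicator hA).aemeasurable]
  refine lintegral_congr_ae (ae_empirical_iff.mpr fun i => ?_)
  beta_reduce
  rw [conditionalKernel_apply F (hη i), withDensity_apply _ (measurable_prodMk_left hA),
    ← lintegral_indicator (measurable_prodMk_left hA)]
  rfl

/-- The conditional density is strictly positive, so each point of the empirical submodel is
absolutely continuous with respect to the completion, as Gibbs' inequality requires. -/
lemma absolutelyContinuous_completion (hη : ∀ i, marginalDensity F η (s i) ≠ ∞) :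
    (empirical s).prod μH ≪ completion F s η := by
  rw [completion_eq_withDensity F hη]
  refine withDensity_absolutelyContinuous' (measurable_conditionalDensity F η).aemeasurable ?_
  filter_upwards [ae_prod_ne_top F hη] with x hx
  exact (ENNReal.div_pos (ENNReal.ofReal_pos.mpr (Real.exp_pos _)).ne' hx).ne'

/-- This is Bayes' formula log p_η(v,h) = log p_η(h|v) + log p_η^V(v), inserted into log p(h|v) -
log p_η(v,h). -/
lemma log_rnDeriv_sub_logDensity_ae_eq (hn : 0 < n) (hη : ∀ i, marginalDensity F η (s i) ≠ ∞)
    (hP : P ∈ empiricalSubmodel μH s) :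
    (fun x => Real.log (P.rnDeriv ((empirical s).prod μH) x).toReal - F.logDensity η x) =ᵐ[P]
      fun x => llr P (completion F s η) x - Real.log (marginalDensity F η x.1).toReal := by
  have := isProbabilityMeasure_empirical hn s
  have := isProbabilityMeasure_of_mem_empiricalSubmodel hn hP
  have hac := absolutelyContinuous_of_mem_empiricalSubmodel hn hP
  have hZ := ae_prod_ne_top F hη
  have hrn := Measure.rnDeriv_withDensity_right P ((empirical s).prod μH)
    (f := fun x => ENNReal.ofReal (Real.exp (F.logDensity η x)) / marginalDensity F η x.1)
    (measurable_conditionalDensity F η).aemeasurable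
    (hZ.mono fun x hx => (ENNReal.div_pos (ENNReal.ofReal_pos.mpr (Real.exp_pos _)).ne' hx).ne')
    (Eventually.of_forall fun x =>
      ENNReal.div_ne_top ENNReal.ofReal_ne_top (marginalDensity_ne_zero F η x.1))
  rw [← completion_eq_withDensity F hη] at hrn
  filter_upwards [hac hrn, Measure.rnDeriv_pos hac, hac (Measure.rnDeriv_lt_top P _), hac hZ]
    with x h1 h2 h3 h4
  have h5 : 0 < (P.rnDeriv ((empirical s).prod μH) x).toReal := ENNReal.toReal_pos h2.ne' h3.ne
  have h6 : 0 < (marginalDensity F η x.1).toReal :=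
    ENNReal.toReal_pos (marginalDensity_ne_zero F η x.1) h4
  have hexp := Real.exp_pos (F.logDensity η x)
  rw [llr, h1, ENNReal.toReal_mul, ENNReal.toReal_inv, ENNReal.toReal_div,
    ENNReal.toReal_ofReal hexp.le, Real.log_mul (by positivity) h5.ne', Real.log_inv,
    Real.log_div hexp.ne' h6.ne', Real.log_exp]
  ring

lemma integrable_log_marginalDensity (hn : 0 < n) (hP : P ∈ empiricalSubmodel μH s) :
    Integrable (fun x => Real.log (marginalDensity F η x.1).toReal) P :=
  integrable_fst_of_mem_empiricalSubmodel hn hP (measurable_marginalDensity F η).ennreal_toReal.log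

/-- The divergence from a point of the empirical model exceeds the negative mean log-likelihood by
the Kullback-Leibler divergence from the completion. -/
lemma integral_conditionalDivergence (hn : 0 < n) (hη : ∀ i, marginalDensity F η (s i) ≠ ∞)
    (hP : P ∈ empiricalSubmodel μH s) (hint : Integrable (llr P (completion F s η)) P) :
    conditionalDivergence F s P η =
      ((∫ x, llr P (completion F s η) x ∂P - meanLogLikelihood F s η : ℝ) : EReal) := by
  have hlog := integrable_log_marginalDensity F (η := η) hn hP
  have hae := log_rnDeriv_sub_logDensity_ae_eq F hn hη hP
  rw [conditionalDivergence, if_pos ((integrable_congr hae).mpr (hint.sub hlog)),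
    integral_congr_ae hae, integral_sub hint hlog,
    integral_fst_of_mem_empiricalSubmodel hP (measurable_marginalDensity F η).ennreal_toReal.log,
    meanLogLikelihood]

theorem neg_meanLogLikelihood_le_conditionalDivergence (hn : 0 < n)
    (hη : ∀ i, marginalDensity F η (s i) ≠ ∞) (hP : P ∈ empiricalSubmodel μH s) :
    ((-meanLogLikelihood F s η : ℝ) : EReal) ≤ conditionalDivergence F s P η := by
  by_cases hint : Integrable (llr P (completion F s η)) P
  · have := isProbabilityMeasure_of_mem_empiricalSubmodel hn hP
    have := isProbabilityMeasure_of_mem_empiricalSubmodel hn (completion_mem F s η)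
    rw [integral_conditionalDivergence F hn hη hP hint, EReal.coe_le_coe_iff]
    have hac := (absolutelyContinuous_of_mem_empiricalSubmodel hn hP).trans
      (absolutelyContinuous_completion F hη)
    -- Gibbs' inequality; the two total masses cancel, both being 1.
    have h := integral_llr_add_sub_measure_univ_nonneg hac hint
    simp only [probReal_univ] at h
    linarith
  -- The marginal term is integrable, so a non-integrable log-likelihood ratio forces the value ⊤.
  · rw [conditionalDivergence, if_neg]
    · exact le_top
    · rw [integrable_congr (log_rnDeriv_sub_logDensity_ae_eq F hn hη hP)]
      intro h
      refine hint ((h.add (integrable_log_marginalDensity F (η := η) hn hP)).congr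
        (Eventually.of_forall fun x => ?_))
      simp

theorem conditionalDivergence_completion (hn : 0 < n)
    (hη : ∀ i, marginalDensity F η (s i) ≠ ∞) :
    conditionalDivergence F s (completion F s η) η = ((-meanLogLikelihood F s η : ℝ) : EReal) := by
  have := isProbabilityMeasure_of_mem_empiricalSubmodel hn (completion_mem F s η)
  have h0 := llr_self (completion F s η)
  rw [integral_conditionalDivergence F hn hη (completion_mem F s η)
    ((integrable_congr h0).mpr (integrable_zero _ _ _)), integral_congr_ae h0]
  simp

/-! ### Orthogonality at the maximum likelihood estimate -/

/-- The mean log-likelihood is differentiable, and its derivatives are the means of the scores under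
the completion. -/
theorem exists_hasFDerivAt_meanLogLikelihood (hn : 0 < n)
    (hfin : ∀ i, ∀ ζ ∈ F.Θ, marginalDensity F ζ (s i) ≠ ∞) (hη : η ∈ F.Θ) :
    ∃ L : Param d →L[ℝ] ℝ, HasFDerivAt (meanLogLikelihood F s) L η ∧
      ∀ u, Integrable (F.score η u) (completion F s η) ∧
        ∫ x, F.score η u x ∂(completion F s η) = L u := by
  have := neZero_of_expFamily F
  have hκ := (conditionalKernel_mem_acTransitions (V := V) F η).1
  obtain ⟨L₀, hL₀, hscore⟩ := F.exists_hasFDerivAt_cumulant hη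
  -- On each fibre the log-partition function has as derivative the conditional mean of T;
  -- subtracting the derivative `L₀` of ψ turns it into the conditional mean of the score.
  choose L hL hmean using fun i => exists_hasFDerivAt_log_integral_exp
    (F.measurable_T.comp (measurable_prodMk_left (x := s i))) F.isOpen_Θ
    (fun ζ hζ => integrable_exp_right F (hfin i ζ hζ)) hη
  have hκi : ∀ i, conditionalKernel F η (s i) = _ := fun i =>
    conditionalKernel_eq_tilted F (hfin i η hη)
  simp only [Function.comp_apply, ← hκi] at hmean
  have hint : ∀ u i, Integrable (fun y => inner ℝ u (F.T (s i, y)) - L₀ u)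
      (conditionalKernel F η (s i)) := fun u i => (hmean i u).1.sub (integrable_const _)
  have hmeas : ∀ u, Measurable fun x => inner ℝ u (F.T x) - L₀ u := fun u => by
    have := F.measurable_T
    fun_prop
  refine ⟨(n : ℝ)⁻¹ • ∑ i, (L i - L₀), ?_, fun u => ?_⟩
  · have h : HasFDerivAt (fun ζ => (n : ℝ)⁻¹ * ∑ i,
        (Real.log (∫ h, Real.exp (inner ℝ ζ (F.T (s i, h))) ∂μH) - F.cumulant ζ))
        ((n : ℝ)⁻¹ • ∑ i, (L i - L₀)) η :=
      (HasFDerivAt.fun_sum fun i _ => (hL i).sub hL₀).const_mul _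
    -- Finiteness of the marginal densities is known on Θ only, which is a neighbourhood of η.
    refine h.congr_of_eventuallyEq ?_
    filter_upwards [F.isOpen_Θ.mem_nhds hη] with ζ hζ
    simp only [meanLogLikelihood, log_marginalDensity F (hfin _ ζ hζ)]
  · rw [(hscore u).1]
    refine ⟨integrable_empirical_compProd hn (hmeas u) (hint u), ?_⟩
    rw [completion, integral_empirical_compProd (hmeas u) (hint u)]
    simp [integral_sub (hmean _ u).1 (integrable_const _), (hmean _ u).2]

theorem isGeodesicProjection_completion {S : Set (Param d)} (hSΘ : S ⊆ F.Θ)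
    (hn : 0 < n) (hfin : ∀ i, ∀ ζ ∈ F.Θ, marginalDensity F ζ (s i) ≠ ∞) (hηS : η ∈ S)
    (hmax : ∀ ζ ∈ S, meanLogLikelihood F s ζ ≤ meanLogLikelihood F s η) :
    IsGeodesicProjection F S (completion F s η) η := by
  obtain ⟨L, hL, hscore⟩ := exists_hasFDerivAt_meanLogLikelihood F hn hfin (hSΘ hηS)
  refine isGeodesicProjection_of_integral_score_eq_zero F hηS (hSΘ hηS) fun u hu => ?_
  refine ⟨(hscore u).1, (hscore u).2.trans ?_⟩
  obtain ⟨γ, rfl, hγS, hγ⟩ := hu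
  refine IsLocalMax.hasDerivAt_eq_zero (f := meanLogLikelihood F s ∘ γ) (a := 0) ?_
    (hL.comp_hasDerivAt 0 hγ)
  exact hγS.mono fun t ht => hmax _ ht

theorem isMaximumLikelihoodEstimate_densityLikelihood_iff {S : Set (Param d)}
    (hSΘ : S ⊆ F.Θ) (hn : 0 < n) (hfin : ∀ i, ∀ ζ ∈ F.Θ, marginalDensity F ζ (s i) ≠ ∞)
    (η : Param d) :
    IsMaximumLikelihoodEstimate (densityLikelihood F s) S η ↔
      ∃ P, IsMinimalGeodesicProjection (conditionalDivergence F s) F (empiricalSubmodel μH s)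
        S P η := by
  have hfin' : ∀ ζ ∈ S, ∀ i, marginalDensity F ζ (s i) ≠ ∞ := fun ζ hζ i => hfin i ζ (hSΘ hζ)
  constructor
  · rintro ⟨hηS, hmax⟩
    replace hmax : ∀ ζ ∈ S, meanLogLikelihood F s ζ ≤ meanLogLikelihood F s η := fun ζ hζ =>
      (densityLikelihood_le_iff F hn (hfin' ζ hζ) (hfin' η hηS)).mp (hmax ζ hζ)
    refine ⟨completion F s η, completion_mem F s η,
      isGeodesicProjection_completion F hSΘ hn hfin hηS hmax, fun P' hP' ζ hζ => ?_⟩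
    rw [conditionalDivergence_completion F hn (hfin' η hηS)]
    refine le_trans ?_ (neg_meanLogLikelihood_le_conditionalDivergence F hn (hfin' ζ hζ) hP')
    exact EReal.coe_le_coe_iff.mpr (neg_le_neg (hmax ζ hζ))
  · rintro ⟨P, hP, ⟨hηS, -⟩, hmin⟩
    refine ⟨hηS, fun ζ hζ => (densityLikelihood_le_iff F hn (hfin' ζ hζ) (hfin' η hηS)).mpr ?_⟩
    -- The chain is -ℓ(η) ≤ D_σ[P‖P_η] ≤ D_σ[completion at ζ‖P_ζ] = -ℓ(ζ).
    have h := (neg_meanLogLikelihood_le_conditionalDivergence F hn (hfin' η hηS) hP).trans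
      (hmin _ (completion_mem F s ζ) ζ hζ)
    rw [conditionalDivergence_completion F hn (hfin' ζ hζ)] at h
    exact neg_le_neg_iff.mp (EReal.coe_le_coe_iff.mp h)

end Divergence

/-! ### Observations of positive mass -/

section PositiveMass

variable {V H : Type*} [MeasurableSpace V] [MeasurableSingletonClass V] [MeasurableSpace H]
  {μV : Measure V} {μH : Measure H} [SigmaFinite μV] [SigmaFinite μH] {d n : ℕ}
  (F : ExpFamily (μV.prod μH) d) {s : Fin n → V} {η : Param d} {P : Measure (V × H)}

lemma dist_singleton_prod (η : Param d) (v : V) :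
    F.dist η ({v} ×ˢ Set.univ) = μV {v} * marginalDensity F η v := by
  have hm := (F.measurable_logDensity η).exp.ennreal_ofReal
  rw [ExpFamily.dist, withDensity_apply _ ((measurableSet_singleton v).prod MeasurableSet.univ),
    ← Measure.prod_restrict, lintegral_prod _ hm.aemeasurable, Measure.restrict_univ,
    Measure.restrict_singleton, lintegral_smul_measure, lintegral_dirac]
  rfl

/-- Otherwise P_η would give infinite mass to the fibre over an atom. -/
lemma marginalDensity_ne_top {v : V} (hv : μV {v} ≠ 0) (hη : η ∈ F.Θ) :
    marginalDensity F η v ≠ ∞ := by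
  have := F.isProbabilityMeasure_dist hη
  intro h
  have h' := dist_singleton_prod F η v
  rw [h, ENNReal.mul_top hv] at h'
  exact measure_ne_top _ _ h'

lemma likelihood_dist (s : Fin n → V) (η : Param d) :
    likelihood s (F.dist η) = (∏ i, μV {s i}) * densityLikelihood F s η := by
  simp only [likelihood, densityLikelihood, dist_singleton_prod, Finset.prod_mul_distrib]

lemma likelihood_dist_le_iff {η' : Param d} (hs : ∀ i, μV {s i} ≠ 0) :
    likelihood s (F.dist η) ≤ likelihood s (F.dist η') ↔
      densityLikelihood F s η ≤ densityLikelihood F s η' := by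
  have h0 : ∏ i, μV {s i} ≠ 0 := Finset.prod_ne_zero_iff.mpr fun i _ => hs i
  have htop : ∏ i, μV {s i} ≠ ∞ := ENNReal.prod_ne_top fun i _ =>
    (measure_singleton_lt_top (μ := μV)).ne
  rw [likelihood_dist, likelihood_dist, ENNReal.mul_le_mul_iff_right h0 htop]

/-- The mean logarithm of the empirical weights, the term of the Kullback-Leibler divergence that
depends on the observation alone. -/
noncomputable def empiricalEntropyTerm (μV : Measure V) (s : Fin n → V) : ℝ :=
  (n : ℝ)⁻¹ * ∑ i, Real.log ((empirical s).rnDeriv μV (s i)).toReal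

/-- Chain rule: dP/dP_η is the product of dP/d(P_σ ⊗ μ_H), dP_σ/dμ_V and 1/p_η. -/
lemma llr_dist_ae_eq (hn : 0 < n) (hs : ∀ i, μV {s i} ≠ 0)
    (hP : P ∈ empiricalSubmodel μH s) :
    llr P (F.dist η) =ᵐ[P] fun x =>
      (Real.log (P.rnDeriv ((empirical s).prod μH) x).toReal - F.logDensity η x) +
        Real.log ((empirical s).rnDeriv μV x.1).toReal := by
  have := isProbabilityMeasure_empirical hn s
  have := isProbabilityMeasure_of_mem_empiricalSubmodel hn hP
  have hac := absolutelyContinuous_of_mem_empiricalSubmodel hn hP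
  have hacV := empirical_absolutelyContinuous hs
  have hprod : (empirical s).prod μH ≪ μV.prod μH := hacV.prod Measure.AbsolutelyContinuous.rfl
  have hacμ := hac.trans hprod
  have h1 := Measure.rnDeriv_withDensity_right P (μV.prod μH)
    (f := fun x => ENNReal.ofReal (Real.exp (F.logDensity η x)))
    (F.measurable_logDensity η).exp.ennreal_ofReal.aemeasurable
    (Eventually.of_forall fun x => (ENNReal.ofReal_pos.mpr (Real.exp_pos _)).ne')
    (Eventually.of_forall fun x => ENNReal.ofReal_ne_top)
  have h2 := Measure.rnDeriv_mul_rnDeriv (κ := μV.prod μH) hac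
  have h3 : ((empirical s).prod μH).rnDeriv (μV.prod μH) =ᵐ[μV.prod μH]
      fun x => (empirical s).rnDeriv μV x.1 := by
    have hw := Measure.measurable_rnDeriv (empirical s) μV
    conv_lhs =>
      rw [← Measure.withDensity_rnDeriv_eq _ _ hacV, prod_withDensity_left hw]
    exact Measure.rnDeriv_withDensity _ (hw.comp measurable_fst)
  filter_upwards [hacμ h1, hacμ h2, hacμ h3, Measure.rnDeriv_pos hac,
    hac (Measure.rnDeriv_lt_top P _), hac (Measure.rnDeriv_pos hprod),
    hacμ (Measure.rnDeriv_lt_top ((empirical s).prod μH) _)] with x e1 e2 e3 p1 p2 q1 q2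
  rw [e3] at q1 q2
  have hp := ENNReal.toReal_pos p1.ne' p2.ne
  have hq := ENNReal.toReal_pos q1.ne' q2.ne
  have hexp := Real.exp_pos (F.logDensity η x)
  have e1' : P.rnDeriv (F.dist η) x = _ := e1
  rw [llr, e1', ← e2, Pi.mul_apply, e3, ENNReal.toReal_mul, ENNReal.toReal_mul,
    ENNReal.toReal_inv, ENNReal.toReal_ofReal hexp.le, Real.log_mul (by positivity) (by positivity),
    Real.log_mul hp.ne' hq.ne', Real.log_inv, Real.log_exp]
  ring

/-- On observations of positive mass, the Kullback-Leibler divergence and the conditional divergence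
differ by a constant. -/
theorem klDiv_dist_eq (hn : 0 < n) (hs : ∀ i, μV {s i} ≠ 0) (hη : η ∈ F.Θ)
    (hP : P ∈ empiricalSubmodel μH s) :
    (klDiv P (F.dist η) : EReal) =
      conditionalDivergence F s P η + (empiricalEntropyTerm μV s : EReal) := by
  have := isProbabilityMeasure_empirical hn s
  have := isProbabilityMeasure_of_mem_empiricalSubmodel hn hP
  have := F.isProbabilityMeasure_dist hη
  have hac : P ≪ F.dist η := ((absolutelyContinuous_of_mem_empiricalSubmodel hn hP).trans
    ((empirical_absolutelyContinuous hs).prod Measure.AbsolutelyContinuous.rfl)).trans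
    (F.absolutelyContinuous_dist η)
  have hae := llr_dist_ae_eq F (η := η) hn hs hP
  have hw := (Measure.measurable_rnDeriv (empirical s) μV).ennreal_toReal.log
  have hwint := integrable_fst_of_mem_empiricalSubmodel hn hP hw
  -- The extra term is integrable, so both divergences are infinite together.
  have hiff : Integrable (llr P (F.dist η)) P ↔
      Integrable (fun x => Real.log (P.rnDeriv ((empirical s).prod μH) x).toReal
        - F.logDensity η x) P := by
    rw [integrable_congr hae]
    exact integrable_add_iff_integrable_left hwint
  by_cases hint : Integrable (llr P (F.dist η)) P
  · have hnonneg := integral_llr_add_sub_measure_univ_nonneg hac hint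
    rw [klDiv_of_ac_of_integrable hac hint, EReal.coe_ennreal_ofReal, max_eq_left hnonneg,
      conditionalDivergence, if_pos (hiff.mp hint), ← EReal.coe_add, integral_congr_ae hae,
      integral_add (hiff.mp hint) hwint, integral_fst_of_mem_empiricalSubmodel hP hw,
      empiricalEntropyTerm]
    simp
  · rw [klDiv_of_not_integrable hint, conditionalDivergence, if_neg (hiff.not.mp hint)]
    simp

lemma klDiv_dist_le_iff {η' : Param d} {P' : Measure (V × H)} (hn : 0 < n)
    (hs : ∀ i, μV {s i} ≠ 0) (hη : η ∈ F.Θ) (hη' : η' ∈ F.Θ)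
    (hP : P ∈ empiricalSubmodel μH s) (hP' : P' ∈ empiricalSubmodel μH s) :
    klDiv P (F.dist η) ≤ klDiv P' (F.dist η') ↔
      conditionalDivergence F s P η ≤ conditionalDivergence F s P' η' := by
  rw [← EReal.coe_ennreal_le_coe_ennreal_iff, klDiv_dist_eq F hn hs hη hP,
    klDiv_dist_eq F hn hs hη' hP']
  refine ⟨fun h => ?_, fun h => add_le_add_left h _⟩
  -- The constant is real, so it cancels even when a divergence is ⊤.
  have h' := add_le_add_left h ((-empiricalEntropyTerm μV s : ℝ) : EReal)
  have hc : (empiricalEntropyTerm μV s : EReal) + ((-empiricalEntropyTerm μV s : ℝ) : EReal) = 0 := by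
    rw [← EReal.coe_add, add_neg_cancel, EReal.coe_zero]
  rwa [add_assoc, add_assoc, hc, add_zero, add_zero] at h'

theorem isMaximumLikelihoodEstimate_likelihood_iff {S : Set (Param d)} (hSΘ : S ⊆ F.Θ)
    (hn : 0 < n) (hs : ∀ i, μV {s i} ≠ 0) (η : Param d) :
    IsMaximumLikelihoodEstimate (fun η' => likelihood s (F.dist η')) S η ↔
      ∃ P, IsMinimalGeodesicProjection (fun P' η' => klDiv P' (F.dist η')) F
        (empiricalSubmodel μH s) S P η := by
  have hL : IsMaximumLikelihoodEstimate (fun η' => likelihood s (F.dist η')) S η ↔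
      IsMaximumLikelihoodEstimate (densityLikelihood F s) S η := by
    simp only [IsMaximumLikelihoodEstimate, likelihood_dist_le_iff F hs]
  rw [hL, isMaximumLikelihoodEstimate_densityLikelihood_iff F hSΘ hn
    (fun i ζ hζ => marginalDensity_ne_top F (hs i) hζ)]
  -- The geodesic condition does not involve the divergence; only minimality has to be transferred.
  refine exists_congr fun P => and_congr_right fun hP => and_congr_right fun hgeo => ?_
  exact forall₄_congr fun P' hP' ζ hζ =>
    (klDiv_dist_le_iff F hn hs (hSΘ hgeo.1) (hSΘ hζ) hP hP').symm

end PositiveMass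

end LatentExp

theorem mainTheorem4
    {V H : Type*} [MeasurableSpace V] [MeasurableSingletonClass V] [MeasurableSpace H]
    (μV : Measure V) (μH : Measure H) [SigmaFinite μV] [SigmaFinite μH]
    (d k n : ℕ) (hn : 0 < n)
    (F : LatentExp.ExpFamily (μV.prod μH) d)
    (S : Set (LatentExp.Param d)) (hSΘ : S ⊆ F.Θ) (hS : LatentExp.IsSmoothSubmanifold k S)
    (s : Fin n → V) :
    -- observed points of positive mass: probabilities and the Kullback-Leibler divergence
    ((∀ i, μV {s i} ≠ 0) →
      ∀ η : LatentExp.Param d,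
        LatentExp.IsMaximumLikelihoodEstimate
            (fun η' => LatentExp.likelihood s (F.dist η')) S η ↔
          ∃ P : Measure (V × H),
            LatentExp.IsMinimalGeodesicProjection
              (fun P' η' => klDiv P' (F.dist η')) F
              (LatentExp.empiricalSubmodel μH s) S P η) ∧
    -- arbitrary observed points: densities and the divergence up to the empirical entropy
    ((∀ i, ∀ η ∈ F.Θ, LatentExp.marginalDensity F η (s i) ≠ ∞) →
      ∀ η : LatentExp.Param d,
        LatentExp.IsMaximumLikelihoodEstimate (LatentExp.densityLikelihood F s) S η ↔
          ∃ P : Measure (V × H),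
            LatentExp.IsMinimalGeodesicProjection
              (LatentExp.conditionalDivergence F s) F
              (LatentExp.empiricalSubmodel μH s) S P η) := by
  exact ⟨fun hs η => LatentExp.isMaximumLikelihoodEstimate_likelihood_iff F hSΘ hn hs η,
    fun hfin η => LatentExp.isMaximumLikelihoodEstimate_densityLikelihood_iff F hSΘ hn hfin η⟩
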